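/- Let $N\in\mathbb{N}$, let $G\in\mathbb{R}^{N\times N}$ be normal, i.e. $GG^\top=G^\top G$, and let $t_0>0$. Consider the dynamics $$\dot q(t)=v(t),\qquad \dot v(t)=-\tfrac{3}{t}\,v(t)-G\,q(t),\qquad t\in[t_0,\infty),$$ i.e. $\ddot q+\tfrac3t\dot q+Gq=0$, with $q(t),v(t)\in\mathbb{R}^N$. A trajectory is a solution $(q,v)$ on $[t_0,\infty)$. Let $\mathcal N(G)=\{x\in\mathbb{R}^N: Gx=0\}$, let $\mathcal N(G)^\perp$ be its orthogonal complement, and let $\|\cdot\|$ be the Euclidean norm. By eigenvalues of $G$ we mean its complex eigenvalues. (a) Suppose that every eigenvalue of $G$ lies in $\mathbb{R}_{\ge 0}$. Then the equilibrium $(0,0)$ is stable: for every $\varepsilon>0$ there is $\delta>0$ such that every trajectory with $\|q(t_0)\|+\|v(t_0)\|<\delta$ satisfies $\|q(t)\|+\|v(t)\|<\varepsilon$ for all $t\ge t_0$. Moreover every trajectory $(q,v)$ is bounded on $[t_0,\infty)$, and as $t\to\infty$ one has $v(t)\to 0$, $q(t)\to q^\infty$ for some $q^\infty\in\mathcal N(G)$,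 and the orthogonal projection of $q(t)$ onto $\mathcal N(G)^\perp$ is $O(t^{-3/2})$. (b) Suppose that some eigenvalue of $G$ does not lie in $\mathbb{R}_{\ge 0}$ (it is a negative real number or is non-real). Then there are initial conditions $(q_0,v_0)\in\mathbb{R}^N\times\mathbb{R}^N$ of arbitrarily small norm leading to exponentially growing trajectories: for every $\varepsilon>0$ there are $q_0,v_0$ with $\|q_0\|+\|v_0\|<\varepsilon$ such that a trajectory with $q(t_0)=q_0$, $v(t_0)=v_0$ exists, and for every such trajectory there are $c,\alpha>0$ with $\|q(t)\|\ge c\,e^{\alpha t}$ for all sufficiently large $t$. -/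

import Mathlib

open Filter Topology Asymptotics

noncomputable section

/-- A real square matrix acting on Euclidean space (with the 2-norm), `x ↦ G x`. -/
def matLin {N : ℕ} (G : Matrix (Fin N) (Fin N) ℝ) :
    EuclideanSpace ℝ (Fin N) →ₗ[ℝ] EuclideanSpace ℝ (Fin N) :=
  Matrix.toEuclideanLin G

/-- The null space `{x : G x = 0}`. -/
def nullSpace {N : ℕ} (G : Matrix (Fin N) (Fin N) ℝ) :
    Submodule ℝ (EuclideanSpace ℝ (Fin N)) :=
  LinearMap.ker (matLin G)

/-- `μ` is a (complex) eigenvalue of the real matrix `G`. -/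
def IsComplexEigenvalue {N : ℕ} (G : Matrix (Fin N) (Fin N) ℝ) (μ : ℂ) : Prop :=
  Module.End.HasEigenvalue (Matrix.toLin' (G.map (fun r : ℝ => (r : ℂ)))) μ

/-- The set `ℝ_{≥ 0}` as a subset of `ℂ`. -/
def nonnegReals : Set ℂ := {z | ∃ r : ℝ, 0 ≤ r ∧ z = (r : ℂ)}

/-- `(q, v)` solves `q'' + (3/t) q' + G q = 0` on `[t₀, ∞)`, in first-order form:
`q' = v` and `v' = -(3/t) v - G q` (one-sided derivatives at `t₀`). -/
structure IsTrajectory {N : ℕ} (G : Matrix (Fin N) (Fin N) ℝ) (t₀ : ℝ)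
    (q v : ℝ → EuclideanSpace ℝ (Fin N)) : Prop where
  deriv_pos : ∀ t, t₀ ≤ t → HasDerivWithinAt q (v t) (Set.Ici t₀) t
  deriv_vel : ∀ t, t₀ ≤ t →
    HasDerivWithinAt v (-((3 / t) • v t) - matLin G (q t)) (Set.Ici t₀) t

/-- Stability of the equilibrium `(0, 0)` for the initial time `t₀`. -/
def IsStable {N : ℕ} (G : Matrix (Fin N) (Fin N) ℝ) (t₀ : ℝ) : Prop :=
  ∀ ε : ℝ, 0 < ε → ∃ δ : ℝ, 0 < δ ∧
    ∀ q v : ℝ → EuclideanSpace ℝ (Fin N), IsTrajectory G t₀ q v →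
      ‖q t₀‖ + ‖v t₀‖ < δ → ∀ t, t₀ ≤ t → ‖q t‖ + ‖v t‖ < ε

/-- `‖q(t)‖ → ∞` exponentially: `‖q(t)‖ ≥ c e^{α t}` for all large `t`, with `c, α > 0`. -/
def GrowsExponentially {N : ℕ} (q : ℝ → EuclideanSpace ℝ (Fin N)) : Prop :=
  ∃ c α : ℝ, 0 < c ∧ 0 < α ∧ ∀ᶠ t in atTop, c * Real.exp (α * t) ≤ ‖q t‖

end

/-! For (a), a real normal matrix with real spectrum is symmetric, so an orthonormal eigenbasis
splits the system into scalar equations `x'' + (3/t) x' + l x = 0` with `l ≥ 0`. For `l = 0` two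
conserved quantities solve the equation. For `l > 0` the substitution `ξ = t^(3/2) x` gives `ξ'' +
(l - 3/(4t²)) ξ = 0`; the perturbation is integrable, so `ξ` and `ξ'` stay bounded and `x`, `x'` are
`O(t^(-3/2))` (`exists_cube_mul_energy_le`).

For (b), a left eigenvector for `μ` gives a functional `L` with `w = L q` solving `w'' + (3/t) w' =
κ² w`, where `κ² = -μ` and `re κ > 0`. Positivity of the mixed form `⟪κ w, w'⟫` at `t₀` forces
exponential growth (`exponential_growth_of_mixed_pos`). The criterion involves initial data only, so
it covers every trajectory with these data without any uniqueness theorem. Data meeting it come from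
the solution regular at the singular time `0`, a Bessel-type power series: there `t³ ⟪κ w, w'⟫`
starts at zero and increases. The criterion survives scaling, hence data of arbitrarily small norm.
-/

/-! ### Exponential growth from the mixed form. -/

lemma le_of_hasDerivWithinAt_nonneg {f f' : ℝ → ℝ} {a : ℝ}
    (hf : ∀ t, a ≤ t → HasDerivWithinAt f (f' t) (Set.Ici a) t)
    (hf' : ∀ t, a ≤ t → 0 ≤ f' t) {s t : ℝ} (hs : a ≤ s) (hst : s ≤ t) : f s ≤ f t := by
  have hmono : MonotoneOn f (Set.Ici a) := by
    refine monotoneOn_of_hasDerivWithinAt_nonneg (f' := f') (convex_Ici a)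
      (fun t ht => (hf t ht).continuousWithinAt) (fun t ht => ?_) (fun t ht => ?_)
    · exact (hf t (interior_subset ht)).mono interior_subset
    · exact hf' t (interior_subset ht)
  exact hmono hs (hs.trans hst) hst

/-- The mixed form `⟪κ w, u⟫` has derivative `α (‖κ w‖² + ‖u‖²) - (3/t) ⟪κ w, u⟫`
along `w' = u`, `u' = κ² w - (3/t) u`. -/
lemma hasDerivWithinAt_mixed {κ : ℂ} {w u : ℝ → ℂ} {u' : ℂ} {s : Set ℝ} {t : ℝ}
    (hw : HasDerivWithinAt w (u t) s t) (hu : HasDerivWithinAt u u' s t) :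
    HasDerivWithinAt (fun t => inner ℝ (κ * w t) (u t))
      (inner ℝ (κ * w t) u' + inner ℝ (κ * u t) (u t)) s t :=
  (hw.const_mul κ).inner ℝ hu

lemma inner_mul_self_eq (κ z : ℂ) : inner ℝ (κ * z) z = κ.re * ‖z‖ ^ 2 := by
  rw [Complex.inner, ← Complex.normSq_eq_norm_sq, Complex.normSq_apply]
  simp
  ring

lemma inner_mul_sq_mul (κ z : ℂ) : inner ℝ (κ * z) (κ ^ 2 * z) = κ.re * ‖κ * z‖ ^ 2 := by
  rw [Complex.inner, ← Complex.normSq_eq_norm_sq, Complex.normSq_apply]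
  simp [pow_two]
  ring

/-- The real adjoint of multiplication by `κ` is multiplication by its conjugate, and the two add up
to `2 re κ`. This makes the derivative of `‖κ w‖² + ‖u‖²` a multiple of the mixed form, up to
friction. -/
lemma two_mul_inner_add (κ z y : ℂ) :
    2 * inner ℝ (κ * z) (κ * y) + 2 * inner ℝ y (κ ^ 2 * z) = 4 * κ.re * inner ℝ (κ * z) y := by
  simp only [Complex.inner]
  simp [pow_two]
  ring

/-- Half of the exponential rate is spent on absorbing `t ^ 3`. -/
lemma eventually_exp_le_of_cube_mul {α c : ℝ} (hα : 0 < α) (hc : 0 < c) {D : ℝ → ℝ}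
    (hD : ∀ᶠ t in atTop, c * Real.exp (2 * α * t) ≤ t ^ 3 * D t) :
    ∀ᶠ t in atTop, c * Real.exp (α * t) ≤ D t := by
  have h1 : ∀ᶠ t : ℝ in atTop, t ^ 3 ≤ Real.exp (α * t) := by
    have := (isLittleO_pow_exp_pos_mul_atTop 3 hα).bound (c := 1) one_pos
    filter_upwards [this, eventually_ge_atTop 0] with t ht h0
    rwa [one_mul, Real.norm_of_nonneg (by positivity), Real.norm_of_nonneg (by positivity)] at ht
  filter_upwards [hD, h1, eventually_gt_atTop 0] with t h h1 h0
  have h3 : 0 < t ^ 3 := by positivity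
  refine le_of_mul_le_mul_left (le_trans ?_ h) h3
  have : Real.exp (2 * α * t) = Real.exp (α * t) * Real.exp (α * t) := by
    rw [← Real.exp_add]; ring_nf
  rw [this]
  have h4 : 0 < c * Real.exp (α * t) := by positivity
  nlinarith

/-- Solutions of `w'' + (3/t) w' = κ² w` with `re κ > 0` and `⟪κ w(t₀), w'(t₀)⟫ > 0` grow
exponentially. -/
theorem exponential_growth_of_mixed_pos {κ : ℂ} (hκ : 0 < κ.re) {t₀ : ℝ} (ht₀ : 0 < t₀)
    {w u : ℝ → ℂ} (hw : ∀ t, t₀ ≤ t → HasDerivWithinAt w (u t) (Set.Ici t₀) t)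
    (hu : ∀ t, t₀ ≤ t →
      HasDerivWithinAt u (-((3 / t) • u t) + κ ^ 2 * w t) (Set.Ici t₀) t)
    (h₀ : 0 < inner ℝ (κ * w t₀) (u t₀)) :
    ∃ c α : ℝ, 0 < c ∧ 0 < α ∧ ∀ᶠ t in atTop, c * Real.exp (α * t) ≤ ‖w t‖ := by
  set α := κ.re with hα
  set D : ℝ → ℝ := fun t => inner ℝ (κ * w t) (u t) with hD
  set T : ℝ → ℝ := fun t => ‖κ * w t‖ ^ 2 + ‖u t‖ ^ 2 with hT
  have hDT : ∀ t, 2 * D t ≤ T t := fun t => by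
    have := real_inner_le_norm (κ * w t) (u t)
    simp only [hD, hT]
    nlinarith [sq_nonneg (‖κ * w t‖ - ‖u t‖)]
  have hD' : ∀ t, t₀ ≤ t → HasDerivWithinAt D (α * T t - 3 / t * D t) (Set.Ici t₀) t := by
    intro t ht
    refine (hasDerivWithinAt_mixed (κ := κ) (hw t ht) (hu t ht)).congr_deriv ?_
    rw [inner_add_right, inner_neg_right, inner_smul_right, inner_mul_self_eq, inner_mul_sq_mul]
    simp only [hD, hT]
    ring
  have hT' : ∀ t, t₀ ≤ t →
      HasDerivWithinAt T (4 * α * D t - 6 / t * ‖u t‖ ^ 2) (Set.Ici t₀) t := by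
    intro t ht
    refine (((hw t ht).const_mul κ).norm_sq.add (hu t ht).norm_sq).congr_deriv ?_
    have := two_mul_inner_add κ (w t) (u t)
    rw [inner_add_right, inner_neg_right, inner_smul_right, real_inner_self_eq_norm_sq]
    simp only [hD]
    linear_combination this
  -- The factor `t ^ 3` integrates out the friction, and `T ≥ 2 D` leaves `(t³ D)' ≥ 2 α t³ D`.
  have hgrow : ∀ t, t₀ ≤ t →
      t₀ ^ 3 * D t₀ * Real.exp (-(2 * α * t₀)) * Real.exp (2 * α * t) ≤ t ^ 3 * D t := by
    intro t ht
    have key := le_of_hasDerivWithinAt_nonneg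
      (f := fun t => t ^ 3 * D t * Real.exp (-(2 * α * t)))
      (f' := fun t => α * t ^ 3 * (T t - 2 * D t) * Real.exp (-(2 * α * t)))
      (a := t₀) (fun t ht => ?_) (fun t ht => ?_) le_rfl ht
    · calc _ ≤ t ^ 3 * D t * Real.exp (-(2 * α * t)) * Real.exp (2 * α * t) := by gcongr
        _ = _ := by rw [mul_assoc, ← Real.exp_add]; simp
    · have ht0 : t ≠ 0 := (ht₀.trans_le ht).ne'
      refine ((((hasDerivAt_pow 3 t).hasDerivWithinAt (s := Set.Ici t₀)).mul (hD' t ht)).mul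
        ((((hasDerivAt_id t).const_mul (2 * α)).neg.exp).hasDerivWithinAt
          (s := Set.Ici t₀))).congr_deriv ?_
      simp only [id, Pi.mul_apply, Pi.neg_apply]
      field_simp
      push_cast
      ring
    · have := ht₀.trans_le ht
      have := hDT t
      have : 0 ≤ T t - 2 * D t := by linarith
      positivity
  set c := t₀ ^ 3 * D t₀ * Real.exp (-(2 * α * t₀)) with hc
  have hc0 : 0 < c := by positivity
  have hDexp : ∀ᶠ t in atTop, c * Real.exp (α * t) ≤ D t :=
    eventually_exp_le_of_cube_mul hκ hc0 ((eventually_ge_atTop t₀).mono hgrow)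
  obtain ⟨t₁, ht₁⟩ := (hDexp.and ((eventually_ge_atTop t₀).and
    ((eventually_ge_atTop (6 / α)).and (eventually_ge_atTop 0)))).exists_forall_of_atTop
  have ht₁₀ : t₀ ≤ t₁ := (ht₁ t₁ le_rfl).2.1
  -- Growth of `D` alone could come from `u`. To bound `w` below, `D - T / 4` is shown to grow at
  -- least linearly: its derivative is at least `2αD - αD - αD/2 ≥ αc/2`, the friction loss being at
  -- most `αD/2` once `t ≥ 6 / α`.
  have hU : ∀ t, t₁ ≤ t →
      D t₁ - T t₁ / 4 - α * c / 2 * t₁ ≤ D t - T t / 4 - α * c / 2 * t := by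
    intro t ht
    refine le_of_hasDerivWithinAt_nonneg (f := fun t => D t - T t / 4 - α * c / 2 * t)
      (f' := fun t => α * T t - 3 / t * D t - (4 * α * D t - 6 / t * ‖u t‖ ^ 2) / 4
        - α * c / 2 * 1) (a := t₁) (fun t ht => ?_) (fun t ht => ?_) le_rfl ht
    · have hsub : Set.Ici t₁ ⊆ Set.Ici t₀ := Set.Ici_subset_Ici.2 ht₁₀
      exact (((hD' t (ht₁₀.trans ht)).mono hsub).sub
        (((hT' t (ht₁₀.trans ht)).mono hsub).div_const 4)).sub
        ((hasDerivAt_id t).const_mul _).hasDerivWithinAt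
    · obtain ⟨h1, h2, h3, h4⟩ := ht₁ t ht
      have htpos := ht₀.trans_le h2
      have h5 : c ≤ D t := le_trans (le_mul_of_one_le_right hc0.le
        (Real.one_le_exp (by positivity))) h1
      have h6 : 3 / t ≤ α / 2 := by
        rw [div_le_iff₀ hκ] at h3
        rw [div_le_iff₀ htpos]; linarith
      have h7 : 3 / t * D t ≤ α / 2 * D t := by gcongr; linarith
      have h8 : 0 ≤ 6 / t * ‖u t‖ ^ 2 := by positivity
      have h9 := hDT t
      nlinarith
  have hU0 : ∀ᶠ t in atTop, T t ≤ 4 * D t := by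
    have : Tendsto (fun t : ℝ => α * c / 2 * t) atTop atTop :=
      tendsto_id.const_mul_atTop (by positivity)
    filter_upwards [this.eventually_ge_atTop (-(D t₁ - T t₁ / 4 - α * c / 2 * t₁)),
      eventually_ge_atTop t₁] with t h1 h2
    linarith [hU t h2]
  have hκ0 : 0 < ‖κ‖ := norm_pos_iff.2 fun h => by simp [hα, h] at hκ
  refine ⟨√c / (2 * ‖κ‖), α / 2, by positivity, by positivity, ?_⟩
  filter_upwards [hU0, hDexp] with t h1 h2
  have h3 : D t ≤ ‖κ * w t‖ * ‖u t‖ := real_inner_le_norm _ _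
  have hDpos : 0 < D t := lt_of_lt_of_le (by positivity) h2
  -- From `‖u‖² ≤ T ≤ 4 D ≤ 4 ‖κ w‖ ‖u‖`; then `D ≤ (2 ‖κ w‖)²`, whose square root halves the rate.
  have h4 : ‖u t‖ ≤ 4 * ‖κ * w t‖ := by
    have h5 : 0 < ‖u t‖ := by
      by_contra h
      have : ‖u t‖ = 0 := le_antisymm (not_lt.1 h) (norm_nonneg _)
      rw [this] at h3; linarith
    refine le_of_mul_le_mul_right (a := ‖u t‖) ?_ h5
    have : ‖u t‖ ^ 2 ≤ T t := by simp only [hT]; nlinarith [sq_nonneg ‖κ * w t‖]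
    nlinarith
  have h5 : c * Real.exp (α * t) ≤ (2 * ‖κ * w t‖) ^ 2 := by
    nlinarith [norm_nonneg (κ * w t)]
  have h6 : √c * Real.exp (α / 2 * t) ≤ 2 * ‖κ * w t‖ := by
    refine (sq_le_sq₀ (by positivity) (by positivity)).1 ?_
    rw [mul_pow, Real.sq_sqrt hc0.le, ← Real.exp_nat_mul]
    have h7 : ((2 : ℕ) : ℝ) * (α / 2 * t) = α * t := by push_cast; ring
    rwa [h7]
  rw [div_mul_eq_mul_div, div_le_iff₀ (by positivity)]
  rw [norm_mul] at h6
  linarith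

/-- A solution of `t w'' + 3 w' = t κ² w` that is regular at `0` enters the growing cone. -/
theorem mixed_pos_of_regular {κ : ℂ} (hκ : 0 < κ.re) {w u u' : ℝ → ℂ}
    (hw : ∀ t, HasDerivAt w (u t) t) (hu : ∀ t, HasDerivAt u (u' t) t)
    (hode : ∀ t, t • u' t = t • (κ ^ 2 * w t) - (3 : ℝ) • u t) (h₀ : w 0 ≠ 0) {t₀ : ℝ}
    (ht₀ : 0 < t₀) : 0 < inner ℝ (κ * w t₀) (u t₀) := by
  set h : ℝ → ℝ := fun t => t ^ 3 * inner ℝ (κ * w t) (u t) with hh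
  have hd : ∀ t, HasDerivAt h (κ.re * t ^ 3 * (‖κ * w t‖ ^ 2 + ‖u t‖ ^ 2)) t := by
    intro t
    have h1 := (hasDerivAt_pow 3 t).mul (hasDerivWithinAt_univ.1
      (hasDerivWithinAt_mixed (κ := κ) (hw t).hasDerivWithinAt (hu t).hasDerivWithinAt))
    refine h1.congr_deriv ?_
    have h2 : t * inner ℝ (κ * w t) (u' t) =
        t * inner ℝ (κ * w t) (κ ^ 2 * w t) - 3 * inner ℝ (κ * w t) (u t) := by
      rw [← real_inner_smul_right, ← real_inner_smul_right, ← real_inner_smul_right,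
        ← inner_sub_right, hode]
    rw [inner_mul_sq_mul] at h2
    rw [inner_mul_self_eq]
    push_cast
    linear_combination t ^ 2 * h2
  have hcont : Continuous h := continuous_iff_continuousAt.2 fun t => (hd t).continuousAt
  have hmono : MonotoneOn h (Set.Ici 0) :=
    monotoneOn_of_hasDerivWithinAt_nonneg (convex_Ici 0) hcont.continuousOn
      (fun t _ => (hd t).hasDerivWithinAt) (fun t ht => by
        have : 0 ≤ t := interior_subset ht
        positivity)
  -- Monotonicity gives only `h t₀ ≥ 0`; strictness comes from `w ≠ 0` near `0`.
  have hw0 : ∀ᶠ t in 𝓝 (0 : ℝ), w t ≠ 0 := (hw 0).continuousAt.eventually_ne h₀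
  obtain ⟨δ, hδ, hδw⟩ := Metric.eventually_nhds_iff.1 hw0
  have hκ0 : κ ≠ 0 := fun h => by simp [h] at hκ
  have hstrict : StrictMonoOn h (Set.Icc 0 (min (δ / 2) t₀)) :=
    strictMonoOn_of_hasDerivWithinAt_pos (convex_Icc _ _) hcont.continuousOn
      (fun t _ => (hd t).hasDerivWithinAt) (fun t ht => by
        rw [interior_Icc] at ht
        have ht0 : 0 < t := ht.1
        have : w t ≠ 0 := hδw (by
          rw [Real.dist_eq, sub_zero, abs_of_pos ht0]
          linarith [ht.2, min_le_left (δ / 2) t₀])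
        have : 0 < ‖κ * w t‖ := norm_pos_iff.2 (mul_ne_zero hκ0 this)
        positivity)
  have hm : 0 < min (δ / 2) t₀ := lt_min (by positivity) ht₀
  have h1 : h 0 < h (min (δ / 2) t₀) := hstrict ⟨le_rfl, hm.le⟩ ⟨hm.le, le_rfl⟩ hm
  have h2 : h (min (δ / 2) t₀) ≤ h t₀ := hmono hm.le ht₀.le (min_le_right _ _)
  have h3 : 0 < t₀ ^ 3 * inner ℝ (κ * w t₀) (u t₀) := by
    have : h 0 = 0 := by simp [hh]
    linarith
  exact pos_of_mul_pos_right h3 (by positivity)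

/-! ### The power series solution regular at the singular time. -/

section Series

variable {E : Type*} [NormedAddCommGroup E] [NormedSpace ℝ E]

lemma sq_le_factorial_succ (k : ℕ) : k ^ 2 ≤ (k + 1).factorial := by
  cases k with
  | zero => simp
  | succ n =>
    have h := Nat.factorial_pos n
    rw [Nat.factorial_succ, Nat.factorial_succ]
    nlinarith

/-- The `k`-th coefficient `B ^ k e / (k! (k+1)!)` of the regular solution. -/
noncomputable def besselCoeff (B : E →L[ℝ] E) (e : E) (k : ℕ) : E :=
  ((k.factorial * (k + 1).factorial : ℝ)⁻¹) • (B ^ k) e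

/-- Two differentiations cost a factor of order `k²`, which `(k+1)!` absorbs; the remaining `k!`
leaves an exponential series. One bound thus serves both derived series. -/
lemma norm_smul_besselCoeff_le (B : E →L[ℝ] E) (e : E) {R : ℝ} {k : ℕ} {a : ℝ}
    (ha : |a| ≤ 4 * k ^ 2 * R ^ k) (hR : 0 ≤ R) :
    ‖a • besselCoeff B e k‖ ≤ 4 * ((R * ‖B‖) ^ k / k.factorial) * ‖e‖ := by
  have h1 : ∀ k, ‖(B ^ k) e‖ ≤ ‖B‖ ^ k * ‖e‖ := fun k => by
    induction k with
    | zero => simp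
    | succ n ih =>
      rw [pow_succ', pow_succ', mul_apply_eq_comp, mul_assoc]
      exact (B.le_opNorm _).trans (by gcongr)
  have h2 : ((k : ℝ)) ^ 2 ≤ (k + 1).factorial := by exact_mod_cast sq_le_factorial_succ k
  have h3 : (0 : ℝ) < k.factorial := by positivity
  have h4 : (0 : ℝ) < (k + 1).factorial := by positivity
  rw [besselCoeff, norm_smul, norm_smul, Real.norm_eq_abs, Real.norm_of_nonneg (by positivity)]
  calc |a| * ((k.factorial * (k + 1).factorial : ℝ)⁻¹ * ‖(B ^ k) e‖)
      ≤ (4 * (k + 1).factorial * R ^ k) *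
        ((k.factorial * (k + 1).factorial : ℝ)⁻¹ * (‖B‖ ^ k * ‖e‖)) := by
        gcongr
        · exact ha.trans (by gcongr)
        · exact h1 k
    _ = _ := by rw [mul_pow]; field_simp

lemma summable_besselBound (B : E →L[ℝ] E) (e : E) (R : ℝ) :
    Summable fun k : ℕ => 4 * ((R * ‖B‖) ^ k / k.factorial) * ‖e‖ :=
  ((Real.summable_pow_div_factorial (R * ‖B‖)).mul_left 4).mul_right ‖e‖

variable [CompleteSpace E]

/-- There is a solution of `t q'' + 3 q' + t A q = 0` regular at `0` with `q(0) = e`. -/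
theorem exists_regular_solution (A : E →L[ℝ] E) (e : E) :
    ∃ q v v' : ℝ → E, q 0 = e ∧ (∀ t, HasDerivAt q (v t) t) ∧ (∀ t, HasDerivAt v (v' t) t) ∧
      ∀ t, t • v' t = -(t • A (q t)) - (3 : ℝ) • v t := by
  set B : E →L[ℝ] E := -((1 / 4 : ℝ) • A) with hB
  set a := besselCoeff B e with ha
  set g : ℕ → ℝ → E := fun k t => t ^ (2 * k) • a k with hg
  -- Truncated subtraction is harmless: at `k = 0` the factor `2 * k` vanishes.
  set g' : ℕ → ℝ → E := fun k t => ((2 * k : ℕ) * t ^ (2 * k - 1)) • a k with hg'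
  set g'' : ℕ → ℝ → E := fun k t =>
    ((2 * k : ℕ) * ((2 * k - 1 : ℕ) * t ^ (2 * k - 1 - 1))) • a k with hg''
  have hdg : ∀ k t, HasDerivAt (g k) (g' k t) t := fun k t => (hasDerivAt_pow _ t).smul_const _
  have hdg' : ∀ k t, HasDerivAt (g' k) (g'' k t) t := fun k t =>
    ((hasDerivAt_pow _ t).const_mul _).smul_const _
  have hpow : ∀ (R t : ℝ) (k m : ℕ), 1 ≤ R → |t| < R → m ≤ 2 * k → |t| ^ m ≤ (R ^ 2) ^ k := by
    intro R t k m hR ht hm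
    rw [← pow_mul]
    calc |t| ^ m ≤ R ^ m := by gcongr
      _ ≤ R ^ (2 * k) := pow_le_pow_right₀ hR hm
  have hbg' : ∀ R t : ℝ, 1 ≤ R → |t| < R → ∀ k,
      ‖g' k t‖ ≤ 4 * ((R ^ 2 * ‖B‖) ^ k / k.factorial) * ‖e‖ := by
    intro R t hR ht k
    refine norm_smul_besselCoeff_le B e ?_ (by positivity)
    have h1 := hpow R t k (2 * k - 1) hR ht (by omega)
    have h2 : (2 * k : ℝ) ≤ 4 * k ^ 2 := by
      have : 2 * k ≤ 4 * k ^ 2 := by nlinarith [Nat.le_self_pow two_ne_zero k]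
      exact_mod_cast this
    rw [abs_mul, abs_pow, Nat.abs_cast]
    push_cast
    gcongr
  have hbg'' : ∀ R t : ℝ, 1 ≤ R → |t| < R → ∀ k,
      ‖g'' k t‖ ≤ 4 * ((R ^ 2 * ‖B‖) ^ k / k.factorial) * ‖e‖ := by
    intro R t hR ht k
    refine norm_smul_besselCoeff_le B e ?_ (by positivity)
    have h1 := hpow R t k (2 * k - 1 - 1) hR ht (by omega)
    have h2 : ((2 * k - 1 : ℕ) : ℝ) ≤ 2 * k := by
      have : 2 * k - 1 ≤ 2 * k := by omega
      exact_mod_cast this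
    rw [abs_mul, abs_mul, abs_pow, Nat.abs_cast, Nat.abs_cast]
    push_cast
    calc (2 * k : ℝ) * (((2 * k - 1 : ℕ) : ℝ) * |t| ^ (2 * k - 1 - 1))
        ≤ 2 * k * (2 * k * (R ^ 2) ^ k) := by gcongr
      _ = _ := by ring
  have hg0 : Summable (g · 0) := by
    refine summable_of_ne_finset_zero (s := {0}) fun k hk => ?_
    have : k ≠ 0 := by simpa using hk
    simp [hg, this]
  have hg'0 : Summable (g' · 0) := by
    refine summable_of_ne_finset_zero (s := ∅) fun k _ => ?_
    rcases k with _ | k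
    · simp [hg']
    · simp [hg', show 2 * (k + 1) - 1 ≠ 0 by omega]
  have hR : ∀ t : ℝ, 1 ≤ |t| + 1 ∧ t ∈ Metric.ball (0 : ℝ) (|t| + 1) ∧
      (0 : ℝ) ∈ Metric.ball (0 : ℝ) (|t| + 1) := fun t => by
    simp; positivity
  have hmem : ∀ {R y : ℝ}, y ∈ Metric.ball (0 : ℝ) R → |y| < R := fun h => by simpa using h
  have hpre : ∀ R : ℝ, IsPreconnected (Metric.ball (0 : ℝ) R) := fun R =>
    (convex_ball 0 R).isPreconnected
  have hsg : ∀ t, Summable (g · t) := fun t =>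
    summable_of_summable_hasDerivAt_of_isPreconnected (summable_besselBound B e ((|t| + 1) ^ 2))
      Metric.isOpen_ball (hpre _) (fun k y _ => hdg k y)
      (fun k y hy => hbg' _ y (hR t).1 (hmem hy) k) (hR t).2.2 hg0 (hR t).2.1
  have hsg' : ∀ t, Summable (g' · t) := fun t =>
    .of_norm_bounded (summable_besselBound B e ((|t| + 1) ^ 2))
      (hbg' _ t (hR t).1 (hmem (hR t).2.1))
  have hsg'' : ∀ t, Summable (g'' · t) := fun t =>
    .of_norm_bounded (summable_besselBound B e ((|t| + 1) ^ 2))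
      (hbg'' _ t (hR t).1 (hmem (hR t).2.1))
  refine ⟨fun t => ∑' k, g k t, fun t => ∑' k, g' k t, fun t => ∑' k, g'' k t, ?_, fun t => ?_,
    fun t => ?_, fun t => ?_⟩
  · change ∑' k, g k 0 = e
    rw [tsum_eq_single 0 fun k hk => by simp [hg, hk]]
    simp [hg, ha, besselCoeff]
  · exact hasDerivAt_tsum_of_isPreconnected (summable_besselBound B e ((|t| + 1) ^ 2))
      Metric.isOpen_ball (hpre _) (fun k y _ => hdg k y)
      (fun k y hy => hbg' _ y (hR t).1 (hmem hy) k) (hR t).2.2 hg0 (hR t).2.1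
  · exact hasDerivAt_tsum_of_isPreconnected (summable_besselBound B e ((|t| + 1) ^ 2))
      Metric.isOpen_ball (hpre _) (fun k y _ => hdg' k y)
      (fun k y hy => hbg'' _ y (hR t).1 (hmem hy) k) (hR t).2.2 hg'0 (hR t).2.1
  -- Comparison of coefficients: `(2k+2)(2k+1) + 3(2k+2) = 4(k+1)(k+2)`, which explains both the
  -- factorials and the `1/4` in `B`.
  · have hstep : ∀ k, t • g'' (k + 1) t + (3 : ℝ) • g' (k + 1) t = -(t • A (g k t)) := by
      intro k
      have hA : ∀ x, A x = (-4 : ℝ) • B x := fun x => by simp [hB, smul_smul]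
      have hBa : B (a k) = ((k + 1) * (k + 2) : ℝ) • a (k + 1) := by
        simp only [ha, besselCoeff, map_smul, smul_smul, pow_succ', mul_apply_eq_comp]
        congr 1
        rw [Nat.factorial_succ (k + 1), Nat.factorial_succ k]
        push_cast
        field_simp
        ring
      simp only [hg, hg', hg'']
      rw [map_smul, hA, hBa, show 2 * (k + 1) - 1 = 2 * k + 1 by omega,
        show 2 * k + 1 - 1 = 2 * k by omega]
      simp only [smul_smul, ← neg_smul, ← add_smul]
      congr 1
      push_cast
      ring
    have h0 : t • g'' 0 t + (3 : ℝ) • g' 0 t = 0 := by simp [hg', hg'']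
    have hsum : t • ∑' k, g'' k t + (3 : ℝ) • ∑' k, g' k t = -(t • A (∑' k, g k t)) := by
      rw [← (hsg'' t).tsum_const_smul, ← (hsg' t).tsum_const_smul,
        ← ((hsg'' t).const_smul t).tsum_add ((hsg' t).const_smul (3 : ℝ)),
        (((hsg'' t).const_smul t).add ((hsg' t).const_smul (3 : ℝ))).tsum_eq_zero_add, h0,
        zero_add, A.map_tsum (hsg t), ← ((hsg t).mapL A).tsum_const_smul, ← tsum_neg]
      exact tsum_congr hstep
    rw [← hsum]
    abel

end Series

/-! ### The scalar equation with nonnegative stiffness. -/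

/-- `(x, y)` solves `x'' + (3/t) x' + l x = 0` on `[t₀, ∞)`, where `y = x'`. -/
structure IsScalarTrajectory (l t₀ : ℝ) (x y : ℝ → ℝ) : Prop where
  deriv_pos : ∀ t, t₀ ≤ t → HasDerivWithinAt x (y t) (Set.Ici t₀) t
  deriv_vel : ∀ t, t₀ ≤ t →
    HasDerivWithinAt y (-(3 / t * y t) - l * x t) (Set.Ici t₀) t

lemma abs_le_mul_rpow_of_cube_mul_sq_le {t a K : ℝ} (ht : 0 < t) (hK : 0 ≤ K)
    (h : t ^ 3 * a ^ 2 ≤ K ^ 2) : |a| ≤ K * t ^ (-(3 / 2) : ℝ) := by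
  refine abs_le_of_sq_le_sq ?_ (by positivity)
  have h1 : (t ^ (-(3 / 2) : ℝ)) ^ 2 = (t ^ 3)⁻¹ := by
    rw [← Real.rpow_natCast, ← Real.rpow_mul ht.le, ← Real.rpow_natCast, ← Real.rpow_neg ht.le]
    norm_num
  rw [mul_pow, h1, ← div_eq_mul_inv, le_div_iff₀ (by positivity)]
  linarith

/-- With `ξ = t^(3/2) x`, the first two factors are the energy `s² ξ² + ξ'²`, whose derivative is
`3/(2t²) ξ ξ'`. The weight `exp (c / t)` supplies a negative term of the same order. -/
lemma IsScalarTrajectory.hasDerivWithinAt_energy {s t₀ c : ℝ} (ht₀ : 0 < t₀) {x y : ℝ → ℝ}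
    (h : IsScalarTrajectory (s ^ 2) t₀ x y) {t : ℝ} (ht : t₀ ≤ t) :
    HasDerivWithinAt
      (fun t => t ^ 3 * (s ^ 2 * x t ^ 2 + (y t + 3 / 2 * (x t / t)) ^ 2) * Real.exp (c * t⁻¹))
      (t * Real.exp (c * t⁻¹) * (3 / 2 * x t * (y t + 3 / 2 * (x t / t)) -
        c * (s ^ 2 * x t ^ 2 + (y t + 3 / 2 * (x t / t)) ^ 2))) (Set.Ici t₀) t := by
  have ht0 : t ≠ 0 := (ht₀.trans_le ht).ne'
  have hx := h.deriv_pos t ht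
  have hz := (h.deriv_vel t ht).add
    ((hx.div (hasDerivWithinAt_id t (Set.Ici t₀)) ht0).const_mul (3 / 2 : ℝ))
  have he := ((hasDerivAt_inv ht0).const_mul c).exp.hasDerivWithinAt (s := Set.Ici t₀)
  refine (((hasDerivAt_pow 3 t).hasDerivWithinAt (s := Set.Ici t₀)).mul
    (((hx.pow 2).const_mul (s ^ 2)).add (hz.pow 2))).mul he |>.congr_deriv ?_
  simp only [id, Pi.add_apply, Pi.mul_apply, Pi.pow_apply, Pi.div_apply, Nat.add_one_sub_one,
    pow_one, Nat.cast_ofNat]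
  field_simp
  ring

/-- For `l > 0` the scaled energy `t³ (x² + x'²)` is bounded. -/
theorem exists_cube_mul_energy_le {l t₀ : ℝ} (hl : 0 < l) (ht₀ : 0 < t₀) :
    ∃ K : ℝ, 0 ≤ K ∧ ∀ x y, IsScalarTrajectory l t₀ x y → ∀ t, t₀ ≤ t →
      t ^ 3 * (x t ^ 2 + y t ^ 2) ≤ (K * (|x t₀| + |y t₀|)) ^ 2 := by
  obtain ⟨s, hs, rfl⟩ : ∃ s : ℝ, 0 < s ∧ l = s ^ 2 :=
    ⟨√l, Real.sqrt_pos.2 hl, (Real.sq_sqrt hl.le).symm⟩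
  -- Chosen so that `2 c s = 3/2`: then `2 s x z ≤ s² x² + z²` makes the weighted energy
  -- nonincreasing.
  set c : ℝ := 3 / (4 * s) with hc
  set M : ℝ := t₀ ^ 3 * (s ^ 2 + (1 + 3 / 2 / t₀) ^ 2) * Real.exp (c * t₀⁻¹) with hM
  set Q : ℝ := M * (1 / s ^ 2 + 2 + 9 / (2 * t₀ ^ 2 * s ^ 2)) with hQ
  have hQ0 : 0 ≤ Q := by positivity
  refine ⟨√Q, by positivity, fun x y h t ht => ?_⟩
  rw [mul_pow, Real.sq_sqrt hQ0]
  set S := |x t₀| + |y t₀| with hS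
  have htpos := ht₀.trans_le ht
  set z : ℝ → ℝ := fun t => y t + 3 / 2 * (x t / t) with hz
  have hdec : t ^ 3 * (s ^ 2 * x t ^ 2 + z t ^ 2) * Real.exp (c * t⁻¹) ≤
      t₀ ^ 3 * (s ^ 2 * x t₀ ^ 2 + z t₀ ^ 2) * Real.exp (c * t₀⁻¹) := by
    have := le_of_hasDerivWithinAt_nonneg
      (fun t ht => (h.hasDerivWithinAt_energy ht₀ (c := c) ht).neg) (fun t ht => ?_) le_rfl ht
    · simpa using this
    · have := ht₀.trans_le ht
      have h1 : c * s * 2 = 3 / 2 := by rw [hc]; field_simp; norm_num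
      have h2 : 0 < c := by positivity
      have h3 : 3 / 2 * x t * z t ≤ c * (s ^ 2 * x t ^ 2 + z t ^ 2) := by
        have h4 : c * s * 2 * (x t * z t) = 3 / 2 * (x t * z t) := by rw [h1]
        linarith [mul_nonneg h2.le (sq_nonneg (s * x t - z t))]
      have h4 : 0 < t * Real.exp (c * t⁻¹) := by positivity
      have h5 : 3 / 2 * x t * z t - c * (s ^ 2 * x t ^ 2 + z t ^ 2) ≤ 0 := by linarith
      exact neg_nonneg.2 (mul_nonpos_of_nonneg_of_nonpos h4.le h5)
  have hx0 : |x t₀| ≤ S := by linarith [abs_nonneg (y t₀)]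
  have hz0 : |z t₀| ≤ (1 + 3 / 2 / t₀) * S := by
    have h1 : |3 / 2 * (x t₀ / t₀)| = 3 / 2 / t₀ * |x t₀| := by
      rw [abs_mul, abs_div (x t₀), abs_of_pos ht₀, abs_of_pos (by norm_num : (0 : ℝ) < 3 / 2)]; ring
    have h2 : 3 / 2 / t₀ * |x t₀| ≤ 3 / 2 / t₀ * S := by gcongr
    have h3 := abs_add_le (y t₀) (3 / 2 * (x t₀ / t₀))
    have : |y t₀| ≤ S := by linarith [abs_nonneg (x t₀)]
    simp only [hz]
    linarith
  have hM' : t₀ ^ 3 * (s ^ 2 * x t₀ ^ 2 + z t₀ ^ 2) * Real.exp (c * t₀⁻¹) ≤ M * S ^ 2 := by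
    have h1 : x t₀ ^ 2 ≤ S ^ 2 := sq_le_sq' (abs_le.1 hx0).1 (abs_le.1 hx0).2
    have h2 : z t₀ ^ 2 ≤ ((1 + 3 / 2 / t₀) * S) ^ 2 := sq_le_sq' (abs_le.1 hz0).1 (abs_le.1 hz0).2
    calc _ ≤ t₀ ^ 3 * (s ^ 2 * S ^ 2 + ((1 + 3 / 2 / t₀) * S) ^ 2) * Real.exp (c * t₀⁻¹) := by
          gcongr
      _ = _ := by rw [hM]; ring
  have hmain : t ^ 3 * (s ^ 2 * x t ^ 2 + z t ^ 2) ≤ M * S ^ 2 := by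
    refine le_trans ?_ (hdec.trans hM')
    exact le_mul_of_one_le_right (by positivity) (Real.one_le_exp (by positivity))
  -- Return from `z` to the velocity, using `t ≥ t₀`; this produces the last two terms of `Q`.
  have hy : y t ^ 2 ≤ 2 * z t ^ 2 + 9 / (2 * t₀ ^ 2) * x t ^ 2 := by
    have h1 : y t = z t - 3 / 2 * (x t / t) := by simp [hz]
    have h2 : (x t / t) ^ 2 ≤ x t ^ 2 / t₀ ^ 2 := by rw [div_pow]; gcongr
    have h3 : 9 / (2 * t₀ ^ 2) * x t ^ 2 = 9 / 2 * (x t ^ 2 / t₀ ^ 2) := by ring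
    rw [h3, h1]
    nlinarith [sq_nonneg (z t + 3 / 2 * (x t / t))]
  have hz2 : t ^ 3 * z t ^ 2 ≤ M * S ^ 2 := by
    have : 0 ≤ t ^ 3 * (s ^ 2 * x t ^ 2) := by positivity
    linarith
  have hx2 : t ^ 3 * x t ^ 2 ≤ M * S ^ 2 / s ^ 2 := by
    rw [le_div_iff₀ (by positivity)]
    have : 0 ≤ t ^ 3 * z t ^ 2 := by positivity
    linarith
  calc t ^ 3 * (x t ^ 2 + y t ^ 2)
      ≤ t ^ 3 * (x t ^ 2 + (2 * z t ^ 2 + 9 / (2 * t₀ ^ 2) * x t ^ 2)) := by gcongr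
    _ = (1 + 9 / (2 * t₀ ^ 2)) * (t ^ 3 * x t ^ 2) + 2 * (t ^ 3 * z t ^ 2) := by ring
    _ ≤ (1 + 9 / (2 * t₀ ^ 2)) * (M * S ^ 2 / s ^ 2) + 2 * (M * S ^ 2) := by gcongr
    _ = Q * S ^ 2 := by rw [hQ]; field_simp; ring

lemma tendsto_rpow_neg_three_halves :
    Tendsto (fun t : ℝ => t ^ (-(3 / 2) : ℝ)) atTop (𝓝 0) :=
  tendsto_rpow_neg_atTop (by norm_num)

lemma IsScalarTrajectory.vel_eq_of_zero {t₀ : ℝ} (ht₀ : 0 < t₀) {x y : ℝ → ℝ}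
    (h : IsScalarTrajectory 0 t₀ x y) {t : ℝ} (ht : t₀ ≤ t) :
    t ^ 3 * y t = t₀ ^ 3 * y t₀ := by
  have hd : ∀ t, t₀ ≤ t → HasDerivWithinAt (fun t => t ^ 3 * y t) 0 (Set.Ici t₀) t := by
    intro t ht
    have ht0 : t ≠ 0 := (ht₀.trans_le ht).ne'
    refine (((hasDerivAt_pow 3 t).hasDerivWithinAt (s := Set.Ici t₀)).mul
      (h.deriv_vel t ht)).congr_deriv ?_
    field_simp
    push_cast
    ring
  have h1 := le_of_hasDerivWithinAt_nonneg hd (fun _ _ => le_rfl) le_rfl ht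
  have h2 := le_of_hasDerivWithinAt_nonneg (fun t ht => (hd t ht).neg) (fun _ _ => by simp)
    le_rfl ht
  simp only [Pi.neg_apply] at h2
  linarith

/-- Second invariant for `l = 0`; since `t * y t` tends to zero, its value is the limit of `x`. -/
lemma IsScalarTrajectory.pos_eq_of_zero {t₀ : ℝ} (ht₀ : 0 < t₀) {x y : ℝ → ℝ}
    (h : IsScalarTrajectory 0 t₀ x y) {t : ℝ} (ht : t₀ ≤ t) :
    x t + t * y t / 2 = x t₀ + t₀ * y t₀ / 2 := by
  have hd : ∀ t, t₀ ≤ t → HasDerivWithinAt (fun t => x t + t * y t / 2) 0 (Set.Ici t₀) t := by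
    intro t ht
    have ht0 : t ≠ 0 := (ht₀.trans_le ht).ne'
    refine ((h.deriv_pos t ht).add (((hasDerivWithinAt_id t (Set.Ici t₀)).mul
      (h.deriv_vel t ht)).div_const 2)).congr_deriv ?_
    simp only [id]
    field_simp
    ring
  have h1 := le_of_hasDerivWithinAt_nonneg hd (fun _ _ => le_rfl) le_rfl ht
  have h2 := le_of_hasDerivWithinAt_nonneg (fun t ht => (hd t ht).neg) (fun _ _ => by simp)
    le_rfl ht
  simp only [Pi.neg_apply] at h2
  linarith

/-- Boundedness and convergence for the scalar equation with `l ≥ 0`. -/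
theorem exists_scalar_bound {l t₀ : ℝ} (hl : 0 ≤ l) (ht₀ : 0 < t₀) :
    ∃ C : ℝ, 0 ≤ C ∧ ∀ x y, IsScalarTrajectory l t₀ x y →
      (∀ t, t₀ ≤ t → |x t| + |y t| ≤ C * (|x t₀| + |y t₀|)) ∧
      Tendsto y atTop (𝓝 0) ∧
      (∃ a, Tendsto x atTop (𝓝 a) ∧ l * a = 0) ∧
      (l ≠ 0 → x =O[atTop] (fun t : ℝ => t ^ (-(3 / 2) : ℝ))) := by
  rcases hl.eq_or_lt with rfl | hl
  · refine ⟨2 + t₀, by positivity, fun x y h => ?_⟩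
    have hy : ∀ t, t₀ ≤ t → y t = t₀ ^ 3 * y t₀ * (t ^ 3)⁻¹ := fun t ht => by
      have : t ≠ 0 := (ht₀.trans_le ht).ne'
      rw [← h.vel_eq_of_zero ht₀ ht]; field_simp
    have hx : ∀ t, t₀ ≤ t → x t = x t₀ + t₀ * y t₀ / 2 - t₀ ^ 3 * y t₀ / 2 * (t ^ 2)⁻¹ :=
      fun t ht => by
        have h0 : t ≠ 0 := (ht₀.trans_le ht).ne'
        rw [← h.vel_eq_of_zero ht₀ ht, ← h.pos_eq_of_zero ht₀ ht]; field_simp; ring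
    refine ⟨fun t ht => ?_, ?_, ⟨x t₀ + t₀ * y t₀ / 2, ?_, zero_mul _⟩, fun h => absurd rfl h⟩
    · have htpos := ht₀.trans_le ht
      have h2 : t ^ 2 * |t * y t| = t₀ ^ 2 * |t₀ * y t₀| := by
        have h4 : t ^ 2 * (t * y t) = t₀ ^ 2 * (t₀ * y t₀) := by
          linear_combination h.vel_eq_of_zero ht₀ ht
        have h5 := congrArg abs h4
        rwa [abs_mul, abs_mul (t₀ ^ 2), abs_of_nonneg (sq_nonneg t),
          abs_of_nonneg (sq_nonneg t₀)] at h5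
      have h3 : |t * y t| ≤ |t₀ * y t₀| := by
        have h4 : t₀ ^ 2 ≤ t ^ 2 := by gcongr
        refine le_of_mul_le_mul_left (a := t₀ ^ 2) ?_ (by positivity)
        rw [← h2]
        gcongr
      have h5 : |y t| ≤ |y t₀| := by
        rw [abs_mul, abs_mul, abs_of_pos htpos, abs_of_pos ht₀] at h3
        refine le_of_mul_le_mul_left (a := t₀) (le_trans ?_ h3) ht₀
        gcongr
      have h6 : |x t| ≤ |x t₀| + t₀ * |y t₀| := by
        have h7 : x t = x t₀ + t₀ * y t₀ / 2 - t * y t / 2 := by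
          linarith [h.pos_eq_of_zero ht₀ ht]
        have h8 : |t₀ * y t₀| = t₀ * |y t₀| := by rw [abs_mul, abs_of_pos ht₀]
        rw [h7, ← h8]
        have h9 := abs_sub (x t₀ + t₀ * y t₀ / 2) (t * y t / 2)
        have h10 := abs_add_le (x t₀) (t₀ * y t₀ / 2)
        rw [abs_div, abs_two] at h9 h10
        linarith
      nlinarith [abs_nonneg (x t₀), abs_nonneg (y t₀)]
    · have h1 : Tendsto (fun t : ℝ => t₀ ^ 3 * y t₀ * (t ^ 3)⁻¹) atTop (𝓝 (t₀ ^ 3 * y t₀ * 0)) :=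
        ((tendsto_pow_atTop three_ne_zero).inv_tendsto_atTop).const_mul _
      rw [mul_zero] at h1
      exact h1.congr' ((eventually_ge_atTop t₀).mono fun t ht => (hy t ht).symm)
    · have h1 : Tendsto (fun t : ℝ => x t₀ + t₀ * y t₀ / 2 - t₀ ^ 3 * y t₀ / 2 * (t ^ 2)⁻¹) atTop
          (𝓝 (x t₀ + t₀ * y t₀ / 2 - t₀ ^ 3 * y t₀ / 2 * 0)) :=
        (((tendsto_pow_atTop two_ne_zero).inv_tendsto_atTop).const_mul _).const_sub _
      rw [mul_zero, sub_zero] at h1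
      exact h1.congr' ((eventually_ge_atTop t₀).mono fun t ht => (hx t ht).symm)
  · obtain ⟨K, hK, hbound⟩ := exists_cube_mul_energy_le hl ht₀
    refine ⟨2 * (K * t₀ ^ (-(3 / 2) : ℝ)), by positivity, fun x y h => ?_⟩
    set S := |x t₀| + |y t₀| with hS
    have hS0 : 0 ≤ K * S := by positivity
    have hx : ∀ t, t₀ ≤ t → |x t| ≤ K * S * t ^ (-(3 / 2) : ℝ) := fun t ht => by
      have htpos := ht₀.trans_le ht
      refine abs_le_mul_rpow_of_cube_mul_sq_le htpos hS0 (le_trans ?_ (hbound x y h t ht))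
      gcongr
      nlinarith [sq_nonneg (y t)]
    have hy : ∀ t, t₀ ≤ t → |y t| ≤ K * S * t ^ (-(3 / 2) : ℝ) := fun t ht => by
      have htpos := ht₀.trans_le ht
      refine abs_le_mul_rpow_of_cube_mul_sq_le htpos hS0 (le_trans ?_ (hbound x y h t ht))
      gcongr
      nlinarith [sq_nonneg (x t)]
    have hlim : Tendsto (fun t : ℝ => K * S * t ^ (-(3 / 2) : ℝ)) atTop (𝓝 0) := by
      simpa using tendsto_rpow_neg_three_halves.const_mul (K * S)
    refine ⟨fun t ht => ?_, ?_, ⟨0, ?_, mul_zero _⟩, fun _ => ?_⟩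
    · have h1 : t ^ (-(3 / 2) : ℝ) ≤ t₀ ^ (-(3 / 2) : ℝ) :=
        Real.rpow_le_rpow_of_nonpos ht₀ ht (by norm_num)
      have h2 : K * S * t ^ (-(3 / 2) : ℝ) ≤ K * S * t₀ ^ (-(3 / 2) : ℝ) := by gcongr
      linarith [hx t ht, hy t ht]
    · exact squeeze_zero_norm' ((eventually_ge_atTop t₀).mono hy) hlim
    · exact squeeze_zero_norm' ((eventually_ge_atTop t₀).mono hx) hlim
    · refine IsBigO.of_bound (K * S) ?_
      filter_upwards [eventually_ge_atTop t₀] with t ht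
      have htpos := ht₀.trans_le ht
      rw [Real.norm_eq_abs, Real.norm_of_nonneg (by positivity)]
      exact hx t ht

/-! ### Eigenbases, left eigenvectors and square roots of eigenvalues. -/

section Spectral

variable {N : ℕ} {G : Matrix (Fin N) (Fin N) ℝ}

open scoped Matrix.Norms.L2Operator in
/-- A real normal matrix whose complex eigenvalues are all real is symmetric. -/
theorem isHermitian_of_normal_of_eigenvalues_real (hG : G * G.transpose = G.transpose * G)
    (h : ∀ μ : ℂ, IsComplexEigenvalue G μ → (μ.re : ℂ) = μ) : G.IsHermitian := by
  set H : Matrix (Fin N) (Fin N) ℂ := G.map (fun r : ℝ => (r : ℂ)) with hH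
  have hstar : star H = G.transpose.map (fun r : ℝ => (r : ℂ)) := by
    ext i j; simp [hH]
  have hmul : ∀ A B : Matrix (Fin N) (Fin N) ℝ,
      (A * B).map (fun r : ℝ => (r : ℂ)) =
        A.map (fun r : ℝ => (r : ℂ)) * B.map (fun r : ℝ => (r : ℂ)) := fun A B => by
    ext i j; simp [Matrix.mul_apply]
  have hnormal : IsStarNormal H := ⟨by
    rw [commute_iff_eq, hstar, hH, ← hmul, ← hmul, hG]⟩
  -- By the continuous functional calculus, a normal element with real spectrum is self-adjoint; the
  -- operator norm makes the matrices a C⋆-algebra.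
  have hspec : SpectrumRestricts H Complex.reCLM := by
    refine SpectrumRestricts.of_rightInvOn Complex.ofReal_re fun x hx => ?_
    refine h x ?_
    rw [IsComplexEigenvalue, Module.End.hasEigenvalue_iff_mem_spectrum, Matrix.spectrum_toLin']
    exact hx
  have hself : IsSelfAdjoint H := hspec.isSelfAdjoint
  ext i j
  have := congrFun (congrFun hself.star_eq i) j
  rw [hstar] at this
  simpa [hH] using this

lemma isComplexEigenvalue_of_eigenvector {l : ℝ} {b : EuclideanSpace ℝ (Fin N)} (hb : b ≠ 0)
    (h : matLin G b = l • b) : IsComplexEigenvalue G l := by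
  refine Module.End.hasEigenvalue_of_hasEigenvector (x := fun i => (b i : ℂ))
    ⟨Module.End.mem_eigenspace_iff.2 ?_, fun h0 => hb ?_⟩
  · ext i
    have := congrArg (fun v : EuclideanSpace ℝ (Fin N) => v i) h
    simp [matLin, Matrix.toLpLin_apply, Matrix.mulVec, dotProduct] at this
    simp only [Matrix.toLin'_apply, Matrix.mulVec, dotProduct, Matrix.map_apply, Pi.smul_apply,
      smul_eq_mul]
    exact_mod_cast this
  · ext i
    simpa using congrFun h0 i

/-- A normal matrix with eigenvalues in `ℝ_{≥ 0}` has an orthonormal eigenbasis with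
non-negative eigenvalues. -/
theorem exists_eigenbasis (hG : G * G.transpose = G.transpose * G)
    (h : ∀ μ : ℂ, IsComplexEigenvalue G μ → μ ∈ nonnegReals) :
    ∃ (b : OrthonormalBasis (Fin N) ℝ (EuclideanSpace ℝ (Fin N))) (l : Fin N → ℝ),
      (∀ i, 0 ≤ l i) ∧ (∀ i, matLin G (b i) = l i • b i) ∧
      ∀ i x, inner ℝ (b i) (matLin G x) = l i * inner ℝ (b i) x := by
  have hH : G.IsHermitian := isHermitian_of_normal_of_eigenvalues_real hG fun μ hμ => by
    obtain ⟨r, -, rfl⟩ := h μ hμ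
    simp
  have hb : ∀ i, matLin G (hH.eigenvectorBasis i) = hH.eigenvalues i • hH.eigenvectorBasis i :=
    fun i => by
      ext j
      exact congrFun (hH.mulVec_eigenvectorBasis i) j
  refine ⟨hH.eigenvectorBasis, hH.eigenvalues, fun i => ?_, hb, fun i x => ?_⟩
  · obtain ⟨r, hr, hrl⟩ := h _ (isComplexEigenvalue_of_eigenvector
      (hH.eigenvectorBasis.orthonormal.ne_zero i) (hb i))
    rwa [Complex.ofReal_injective hrl]
  · have hs : (matLin G).IsSymmetric := Matrix.isSymmetric_toEuclideanLin_iff.2 hH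
    rw [← hs, hb, real_inner_smul_left]

/-- Every complex eigenvalue of `G` has a left eigenvector, viewed as a functional. -/
theorem exists_left_eigenfunctional {μ : ℂ} (hμ : IsComplexEigenvalue G μ) :
    ∃ L : EuclideanSpace ℝ (Fin N) →L[ℝ] ℂ, L ≠ 0 ∧ ∀ x, L (matLin G x) = μ * L x := by
  set H : Matrix (Fin N) (Fin N) ℂ := G.map (fun r : ℝ => (r : ℂ)) with hH
  -- A matrix and its transpose share their characteristic polynomial, so normality is not needed.
  have hT : Module.End.HasEigenvalue (Matrix.toLin' H.transpose) μ := by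
    rw [IsComplexEigenvalue, Module.End.hasEigenvalue_iff_mem_spectrum, Matrix.spectrum_toLin',
      Matrix.mem_spectrum_iff_isRoot_charpoly] at hμ
    rw [Module.End.hasEigenvalue_iff_mem_spectrum, Matrix.spectrum_toLin',
      Matrix.mem_spectrum_iff_isRoot_charpoly, Matrix.charpoly_transpose]
    exact hμ
  obtain ⟨z, hz⟩ := hT.exists_hasEigenvector
  have hz1 : ∀ j, ∑ i, z i * (G i j : ℂ) = μ * z j := fun j => by
    have := congrFun hz.apply_eq_smul j
    simp only [Matrix.toLin'_apply, Matrix.mulVec, dotProduct, Matrix.transpose_apply, hH,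
      Matrix.map_apply, Pi.smul_apply, smul_eq_mul] at this
    rw [← this]
    exact Finset.sum_congr rfl fun i _ => mul_comm _ _
  let L : EuclideanSpace ℝ (Fin N) →ₗ[ℝ] ℂ :=
    { toFun := fun x => ∑ i, z i * (x i : ℂ)
      map_add' := fun x y => by simp [mul_add, Finset.sum_add_distrib]
      map_smul' := fun r x => by
        simp only [PiLp.smul_apply, smul_eq_mul, Complex.ofReal_mul, RingHom.id_apply,
          Complex.real_smul, Finset.mul_sum]
        exact Finset.sum_congr rfl fun i _ => by ring }
  refine ⟨L.toContinuousLinearMap, fun h0 => hz.2 ?_, fun x => ?_⟩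
  · ext j
    have := congrArg (fun f => f (EuclideanSpace.single j (1 : ℝ))) h0
    simpa [L, Pi.single_apply, apply_ite Complex.ofReal] using this
  · change ∑ i, z i * ((matLin G x) i : ℂ) = μ * ∑ i, z i * (x i : ℂ)
    have hGx : ∀ i, ((matLin G x) i : ℂ) = ∑ j, (G i j : ℂ) * (x j : ℂ) := fun i => by
      simp [matLin, Matrix.toLpLin_apply, Matrix.mulVec, dotProduct]
    simp only [hGx, Finset.mul_sum]
    rw [Finset.sum_comm]
    refine Finset.sum_congr rfl fun j _ => ?_
    rw [← mul_assoc, ← hz1, Finset.sum_mul]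
    exact Finset.sum_congr rfl fun i _ => by ring

/-- Off the branch cut the argument of `-μ` lies strictly between `-π` and `π`, so the principal
square root lies in the open right half-plane. -/
lemma exists_sq_eq_neg_of_not_mem_nonnegReals {μ : ℂ} (hμ : μ ∉ nonnegReals) :
    ∃ κ : ℂ, 0 < κ.re ∧ κ ^ 2 = -μ := by
  have h0 : -μ ≠ 0 := fun h => hμ ⟨0, le_rfl, by simpa using h⟩
  have harg : (-μ).arg ≠ Real.pi := fun h => hμ <| by
    rw [Complex.arg_eq_pi_iff] at h
    refine ⟨μ.re, by simpa using h.1.le, Complex.ext rfl (by simpa using h.2)⟩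
  refine ⟨Complex.exp (Complex.log (-μ) / 2), ?_, ?_⟩
  · rw [Complex.exp_re]
    refine mul_pos (Real.exp_pos _) (Real.cos_pos_of_mem_Ioo ?_)
    have h1 := Complex.neg_pi_lt_arg (-μ)
    have h2 := lt_of_le_of_ne (Complex.arg_le_pi (-μ)) harg
    have h3 : (Complex.log (-μ) / 2).im = (-μ).arg / 2 := by
      rw [← Complex.log_im]; simp
    rw [h3]
    constructor <;> linarith
  · rw [← Complex.exp_nat_mul, show ((2 : ℕ) : ℂ) * (Complex.log (-μ) / 2) = Complex.log (-μ) by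
      push_cast; ring, Complex.exp_log h0]

end Spectral

/-! ### Reassembling the scalar modes. -/

section Convergent

variable {N : ℕ} {G : Matrix (Fin N) (Fin N) ℝ} {t₀ : ℝ}

lemma IsTrajectory.inner_eigenvector {q v : ℝ → EuclideanSpace ℝ (Fin N)}
    (h : IsTrajectory G t₀ q v) {b : EuclideanSpace ℝ (Fin N)} {l : ℝ}
    (hb : ∀ x, inner ℝ b (matLin G x) = l * inner ℝ b x) :
    IsScalarTrajectory l t₀ (fun t => inner ℝ b (q t)) (fun t => inner ℝ b (v t)) where
  deriv_pos t ht := (innerSL ℝ b).hasFDerivAt.comp_hasDerivWithinAt t (h.deriv_pos t ht)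
  deriv_vel t ht := by
    refine ((innerSL ℝ b).hasFDerivAt.comp_hasDerivWithinAt t (h.deriv_vel t ht)).congr_deriv ?_
    rw [innerSL_apply_apply, inner_sub_right, inner_neg_right, real_inner_smul_right, hb]

/-- All conclusions for trajectories of a matrix diagonalised by an orthonormal basis, with
a bound that is uniform in the trajectory. -/
theorem exists_bound_of_eigenbasis (ht₀ : 0 < t₀)
    {b : OrthonormalBasis (Fin N) ℝ (EuclideanSpace ℝ (Fin N))} {l : Fin N → ℝ}
    (hl : ∀ i, 0 ≤ l i) (hb : ∀ i, matLin G (b i) = l i • b i)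
    (hb' : ∀ i x, inner ℝ (b i) (matLin G x) = l i * inner ℝ (b i) x) :
    ∃ C : ℝ, 0 ≤ C ∧ ∀ q v, IsTrajectory G t₀ q v →
      (∀ t, t₀ ≤ t → ‖q t‖ + ‖v t‖ ≤ C * (‖q t₀‖ + ‖v t₀‖)) ∧
      Tendsto v atTop (𝓝 0) ∧
      (∃ qInf ∈ nullSpace G, Tendsto q atTop (𝓝 qInf)) ∧
      (fun t : ℝ => (nullSpace G)ᗮ.starProjection (q t))
        =O[atTop] (fun t : ℝ => t ^ (-(3 / 2) : ℝ)) := by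
  choose C hC0 hC using fun i => exists_scalar_bound (hl i) ht₀
  have hnorm : ∀ x : EuclideanSpace ℝ (Fin N), ‖x‖ ≤ ∑ i, |inner ℝ (b i) x| := fun x => by
    conv_lhs => rw [← b.sum_repr' x]
    refine (norm_sum_le _ _).trans (Finset.sum_le_sum fun i _ => ?_)
    rw [norm_smul, b.norm_eq_one, mul_one, Real.norm_eq_abs]
  have hcoord : ∀ i x, |inner ℝ (b i) x| ≤ ‖x‖ := fun i x => by
    simpa [b.norm_eq_one] using abs_real_inner_le_norm (b i) x
  refine ⟨∑ i, C i, Finset.sum_nonneg fun i _ => hC0 i, fun q v h => ?_⟩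
  have hi := fun i => hC i _ _ (h.inner_eigenvector (hb' i))
  have hq : ∀ t, q t = ∑ i, inner ℝ (b i) (q t) • b i := fun t => (b.sum_repr' (q t)).symm
  have hv : ∀ t, v t = ∑ i, inner ℝ (b i) (v t) • b i := fun t => (b.sum_repr' (v t)).symm
  choose a ha ha0 using fun i => (hi i).2.2.1
  refine ⟨fun t ht => ?_, ?_, ⟨∑ i, a i • b i, ?_, ?_⟩, ?_⟩
  · calc ‖q t‖ + ‖v t‖ ≤ ∑ i, (|inner ℝ (b i) (q t)| + |inner ℝ (b i) (v t)|) := by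
          rw [Finset.sum_add_distrib]
          exact add_le_add (hnorm _) (hnorm _)
      _ ≤ ∑ i, C i * (‖q t₀‖ + ‖v t₀‖) := Finset.sum_le_sum fun i _ =>
          ((hi i).1 t ht).trans (mul_le_mul_of_nonneg_left
            (add_le_add (hcoord _ _) (hcoord _ _)) (hC0 i))
      _ = _ := by rw [Finset.sum_mul]
  · rw [funext hv]
    have := tendsto_finsetSum Finset.univ fun i _ => (hi i).2.1.smul_const (b i)
    simpa using this
  · rw [nullSpace, LinearMap.mem_ker, map_sum]
    refine Finset.sum_eq_zero fun i _ => ?_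
    rw [map_smul, hb, smul_smul, mul_comm, ha0, zero_smul]
  · rw [funext hq]
    exact tendsto_finsetSum Finset.univ fun i _ => (ha i).smul_const (b i)
  · have hproj : ∀ t, (nullSpace G)ᗮ.starProjection (q t) =
        ∑ i, inner ℝ (b i) (q t) • (nullSpace G)ᗮ.starProjection (b i) := fun t => by
      conv_lhs => rw [hq t]
      simp
    rw [funext hproj]
    refine IsBigO.fun_sum fun i _ => ?_
    -- Modes with `l i = 0` need not decay, but the projection kills them.
    by_cases h0 : l i = 0
    · have hmem : b i ∈ nullSpace G := by
        rw [nullSpace, LinearMap.mem_ker, hb, h0, zero_smul]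
      have : (nullSpace G)ᗮ.starProjection (b i) = 0 := by
        rw [Submodule.starProjection_apply_eq_zero_iff]
        exact Submodule.le_orthogonal_orthogonal _ hmem
      simp only [this, smul_zero]
      exact isBigO_zero _ _
    · have h1 := (hi i).2.2.2 h0
      have h2 := h1.smul (isBigO_refl (fun _ : ℝ => (nullSpace G)ᗮ.starProjection (b i)) atTop)
      refine h2.trans ?_
      refine IsBigO.of_bound ‖(nullSpace G)ᗮ.starProjection (b i)‖ (.of_forall fun t => ?_)
      rw [norm_smul, mul_comm]

end Convergent

/-! ### Trajectories that grow exponentially. -/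

section Divergent

variable {N : ℕ} {G : Matrix (Fin N) (Fin N) ℝ} {t₀ : ℝ}

/-- A trajectory on which a left eigenfunctional satisfies the growth condition at `t₀` grows
exponentially. -/
theorem IsTrajectory.growsExponentially (ht₀ : 0 < t₀) {q v : ℝ → EuclideanSpace ℝ (Fin N)}
    (h : IsTrajectory G t₀ q v) {L : EuclideanSpace ℝ (Fin N) →L[ℝ] ℂ} {μ κ : ℂ}
    (hL0 : L ≠ 0) (hL : ∀ x, L (matLin G x) = μ * L x) (hκ : 0 < κ.re) (hκμ : κ ^ 2 = -μ)
    (h₀ : 0 < inner ℝ (κ * L (q t₀)) (L (v t₀))) : GrowsExponentially q := by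
  obtain ⟨c, α, hc, hα, hgrow⟩ := exponential_growth_of_mixed_pos hκ ht₀
    (w := fun t => L (q t)) (u := fun t => L (v t))
    (fun t ht => L.hasFDerivAt.comp_hasDerivWithinAt t (h.deriv_pos t ht))
    (fun t ht => (L.hasFDerivAt.comp_hasDerivWithinAt t (h.deriv_vel t ht)).congr_deriv (by
      rw [map_sub, map_neg, map_smul, hL, hκμ]; ring)) h₀
  have hLpos : 0 < ‖L‖ := norm_pos_iff.2 hL0
  refine ⟨c / ‖L‖, α, by positivity, hα, hgrow.mono fun t ht => ?_⟩
  rw [div_mul_eq_mul_div, div_le_iff₀ hLpos, mul_comm ‖q t‖]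
  exact ht.trans (L.le_opNorm _)

lemma IsTrajectory.const_smul {q v : ℝ → EuclideanSpace ℝ (Fin N)} (h : IsTrajectory G t₀ q v)
    (r : ℝ) : IsTrajectory G t₀ (fun t => r • q t) (fun t => r • v t) where
  deriv_pos t ht := (h.deriv_pos t ht).const_smul r
  deriv_vel t ht := ((h.deriv_vel t ht).const_smul r).congr_deriv (by
    rw [map_smul, smul_sub, smul_neg, smul_comm])

/-- An eigenvalue outside `ℝ_{≥ 0}` has a trajectory satisfying the growth condition. -/
theorem exists_trajectory_mixed_pos (ht₀ : 0 < t₀) {L : EuclideanSpace ℝ (Fin N) →L[ℝ] ℂ}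
    {μ κ : ℂ} (hL0 : L ≠ 0) (hL : ∀ x, L (matLin G x) = μ * L x) (hκ : 0 < κ.re)
    (hκμ : κ ^ 2 = -μ) :
    ∃ q v, IsTrajectory G t₀ q v ∧ 0 < inner ℝ (κ * L (q t₀)) (L (v t₀)) := by
  obtain ⟨e, he⟩ : ∃ e, L e ≠ 0 := by
    by_contra! h
    exact hL0 (ContinuousLinearMap.ext h)
  obtain ⟨q, v, v', hq0, hq, hv, hode⟩ :=
    exists_regular_solution (matLin G).toContinuousLinearMap e
  refine ⟨q, v, ⟨fun t _ => (hq t).hasDerivWithinAt, fun t ht => ?_⟩, ?_⟩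
  · have ht0 : t ≠ 0 := (ht₀.trans_le ht).ne'
    refine (hv t).hasDerivWithinAt.congr_deriv ?_
    rw [← inv_smul_smul₀ ht0 (v' t), hode, smul_sub, smul_neg, inv_smul_smul₀ ht0, smul_smul,
      inv_mul_eq_div, LinearMap.coe_toContinuousLinearMap']
    abel
  · refine mixed_pos_of_regular hκ (w := fun t => L (q t)) (u := fun t => L (v t))
      (u' := fun t => L (v' t)) (fun t => L.hasFDerivAt.comp_hasDerivAt t (hq t))
      (fun t => L.hasFDerivAt.comp_hasDerivAt t (hv t)) (fun t => ?_) (by rwa [hq0]) ht₀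
    have := congrArg L (hode t)
    rw [map_smul, map_sub, map_neg, map_smul, map_smul,
      LinearMap.coe_toContinuousLinearMap', hL] at this
    rw [this, hκμ]
    simp

end Divergent

theorem mainTheorem4 (N : ℕ) (G : Matrix (Fin N) (Fin N) ℝ)
    (hG : G * G.transpose = G.transpose * G) (t₀ : ℝ) (ht₀ : 0 < t₀) :
    ((∀ μ : ℂ, IsComplexEigenvalue G μ → μ ∈ nonnegReals) →
      IsStable G t₀ ∧
      ∀ q v : ℝ → EuclideanSpace ℝ (Fin N), IsTrajectory G t₀ q v →
        (∃ M : ℝ, ∀ t, t₀ ≤ t → ‖q t‖ + ‖v t‖ ≤ M) ∧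
        Tendsto v atTop (𝓝 0) ∧
        (∃ qInf ∈ nullSpace G, Tendsto q atTop (𝓝 qInf)) ∧
        (fun t : ℝ => (nullSpace G)ᗮ.starProjection (q t))
          =O[atTop] (fun t : ℝ => t ^ (-(3 / 2) : ℝ))) ∧
    ((∃ μ : ℂ, IsComplexEigenvalue G μ ∧ μ ∉ nonnegReals) →
      ∀ ε : ℝ, 0 < ε → ∃ q₀ v₀ : EuclideanSpace ℝ (Fin N),
        ‖q₀‖ + ‖v₀‖ < ε ∧
        (∃ q v : ℝ → EuclideanSpace ℝ (Fin N),
          IsTrajectory G t₀ q v ∧ q t₀ = q₀ ∧ v t₀ = v₀) ∧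
        ∀ q v : ℝ → EuclideanSpace ℝ (Fin N),
          IsTrajectory G t₀ q v → q t₀ = q₀ → v t₀ = v₀ → GrowsExponentially q) := by
  refine ⟨fun h => ?_, fun ⟨μ, hμ, hμn⟩ ε hε => ?_⟩
  · obtain ⟨b, l, hl, hb, hb'⟩ := exists_eigenbasis hG h
    obtain ⟨C, hC0, hC⟩ := exists_bound_of_eigenbasis ht₀ hl hb hb'
    refine ⟨fun ε hε => ⟨ε / (C + 1), by positivity, fun q v hqv hδ t ht => ?_⟩,
      fun q v hqv => ⟨⟨_, (hC q v hqv).1⟩, (hC q v hqv).2⟩⟩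
    rw [lt_div_iff₀ (by positivity)] at hδ
    have := (hC q v hqv).1 t ht
    have : 0 ≤ ‖q t₀‖ + ‖v t₀‖ := by positivity
    linarith
  · obtain ⟨L, hL0, hL⟩ := exists_left_eigenfunctional hμ
    obtain ⟨κ, hκ, hκμ⟩ := exists_sq_eq_neg_of_not_mem_nonnegReals hμn
    obtain ⟨q, v, hqv, hpos⟩ := exists_trajectory_mixed_pos ht₀ hL0 hL hκ hκμ
    set S := ‖q t₀‖ + ‖v t₀‖ with hS
    have hS0 : 0 ≤ S := by positivity
    -- The mixed form is quadratic, so scaling by `r > 0` multiplies it by `r²` and keeps it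
    -- positive.
    set r := ε / (S + 1) with hr
    have hr0 : 0 < r := by positivity
    refine ⟨r • q t₀, r • v t₀, ?_, ⟨_, _, hqv.const_smul r, rfl, rfl⟩,
      fun q' v' h' hq' hv' => h'.growsExponentially ht₀ hL0 hL hκ hκμ ?_⟩
    · rw [norm_smul, norm_smul, ← mul_add, Real.norm_of_nonneg hr0.le, ← hS, hr,
        div_mul_eq_mul_div, div_lt_iff₀ (by positivity)]
      linarith
    · rw [hq', hv', map_smul, map_smul, mul_smul_comm, real_inner_smul_left,
        real_inner_smul_right]
      positivity
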